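/- Write $\mathbb{R}_+=[0,\infty)$ and $\mathbb{N}=\{1,2,\dots\}$. Let $\nu,\mu$ be Borel probability measures on $\mathbb{R}_+$ and let $\xi=(\xi_\ell)_{\ell\in\mathbb{N}}$ be an $\mathbb{R}_+$-valued stochastic process such that $\xi_\ell\stackrel{d}{=}\nu$ for all $\ell\in\mathbb{N}$ and $(\xi_\ell,\xi_k)\stackrel{d}{=}(\xi_{\ell+\tau},\xi_{k+\tau})$ for all $\ell,k,\tau\in\mathbb{N}$. For $n\in\mathbb{N}$ let $$\alpha_n=\sup\bigl\{|\mathbb{P}(A\cap B)-\mathbb{P}(A)\mathbb{P}(B)| : k\in\mathbb{N},\ A\in\sigma(\xi_1,\dots,\xi_k),\ B\in\sigma(\xi_{k+n},\xi_{k+n+1},\dots)\bigr\},$$ and assume that $\sum_{n\ge1}\alpha_n<\infty$ and that there are integer sequences $p=p(n)$, $q=q(n)$ such that, as $n\to\infty$, $p\to\infty$, $q\to\infty$, $q=o(p)$, $p=o(n)$, $n p^{-1}\alpha_q=o(1)$ and $\frac pn\sum_{j=1}^p j\alpha_j=o(1)$. Let $g:\mathbb{R}_+^2\to\mathbb{R}$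 be bounded and measurable. Let $V$ have law $\nu$ and let $U,U'$ have law $\mu$, with $V,U,U'$ independent and $(U,U')$ independent of $\xi$, and put $\tilde g(x,y)=g(x,y)-\mathbb{E}[g(V,y)]$. Then the quantity $$\rho_g^2=\mathbb{E}\bigl[\tilde g(V,U)^2\bigr]+2\sum_{k=1}^\infty\mathbb{E}\bigl[\tilde g(\xi_1,U)\,\tilde g(\xi_{1+k},U')\bigr]$$ is finite (the series converges absolutely) and nonnegative. Moreover, for $\mu^{\mathbb{N}}$-almost every sequence $(s_i)_{i\in\mathbb{N}}\in\mathbb{R}_+^{\mathbb{N}}$, $$\frac{\sum_{j=1}^{2n-1}\tilde g(\xi_j,s_j)}{\sqrt{2n}}\xrightarrow{d}\mathcal{N}(0,\rho_g^2)\qquad\text{as } n\to\infty,$$ where $\mathcal{N}(0,0)$ is the Dirac mass at $0$. -/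

import Mathlib

open MeasureTheory ProbabilityTheory Filter Topology Asymptotics
open scoped NNReal

/- Throughout, sequences are indexed from `1`: a process is a map `ξ : ℕ → Ω → ℝ≥0` of which only
the variables `ξ 1, ξ 2, …` are ever used (the value at index `0` is a dummy). -/

namespace QuenchedCLT

noncomputable section

/-- The random variables `ξ 1, ξ 2, …` all have law `ν`, and the joint law of a pair
`(ξ ℓ, ξ k)` is invariant under a common shift of the two times. -/
structure IsPairStationary {Ω : Type*} [MeasurableSpace Ω] (P : Measure Ω)
    (ν : Measure ℝ≥0) (ξ : ℕ → Ω → ℝ≥0) : Prop where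
  measurable : ∀ ℓ, 1 ≤ ℓ → Measurable (ξ ℓ)
  law_eq : ∀ ℓ, 1 ≤ ℓ → P.map (ξ ℓ) = ν
  pair_law_eq : ∀ ℓ k τ, 1 ≤ ℓ → 1 ≤ k → 1 ≤ τ →
    P.map (fun ω => (ξ ℓ ω, ξ k ω)) = P.map (fun ω => (ξ (ℓ + τ) ω, ξ (k + τ) ω))

/-- The σ-algebra generated by `ξ 1, …, ξ k`. -/
def pastSigma {Ω : Type*} (ξ : ℕ → Ω → ℝ≥0) (k : ℕ) : MeasurableSpace Ω :=
  ⨆ i ∈ Set.Icc 1 k, MeasurableSpace.comap (ξ i) inferInstance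

/-- The σ-algebra generated by `ξ k, ξ (k+1), …`. -/
def futureSigma {Ω : Type*} (ξ : ℕ → Ω → ℝ≥0) (k : ℕ) : MeasurableSpace Ω :=
  ⨆ i ∈ Set.Ici k, MeasurableSpace.comap (ξ i) inferInstance

/-- The strong mixing coefficient: the supremum of `|P(A ∩ B) - P(A) P(B)|` over `k ≥ 1`,
`A ∈ σ(ξ 1, …, ξ k)` and `B ∈ σ(ξ (k+n), ξ (k+n+1), …)`. -/
def alpha {Ω : Type*} [MeasurableSpace Ω] (P : Measure Ω) (ξ : ℕ → Ω → ℝ≥0) (n : ℕ) : ℝ :=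
  sSup {r : ℝ | ∃ k : ℕ, 1 ≤ k ∧ ∃ A B : Set Ω,
    MeasurableSet[pastSigma ξ k] A ∧ MeasurableSet[futureSigma ξ (k + n)] B ∧
      r = |P.real (A ∩ B) - P.real A * P.real B|}

/-- Admissible lengths `p n` of the big blocks and `q n` of the small blocks, for mixing
coefficients `a`. -/
structure IsBlockPair (a : ℕ → ℝ) (p q : ℕ → ℕ) : Prop where
  p_tendsto : Tendsto p atTop atTop
  q_tendsto : Tendsto q atTop atTop
  q_isLittleO : (fun n => (q n : ℝ)) =o[atTop] (fun n => (p n : ℝ))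
  p_isLittleO : (fun n => (p n : ℝ)) =o[atTop] (fun n : ℕ => (n : ℝ))
  mixing_q : Tendsto (fun n : ℕ => (n : ℝ) * (p n : ℝ)⁻¹ * a (q n)) atTop (𝓝 0)
  mixing_p : Tendsto
    (fun n : ℕ => (p n : ℝ) / (n : ℝ) * ∑ j ∈ Finset.Icc 1 (p n), (j : ℝ) * a j) atTop (𝓝 0)

/-- The centered function `g̃ (x, y) = g (x, y) - E[g (V, y)]`, where `V` has law `ν`. -/
def centered (ν : Measure ℝ≥0) (g : ℝ≥0 × ℝ≥0 → ℝ) (z : ℝ≥0 × ℝ≥0) : ℝ :=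
  g z - ∫ v, g (v, z.2) ∂ν

/-- The random variable `g̃ (ξ 1, U) * g̃ (ξ (1+k), U')`, where `U`, `U'` are the two coordinates of
the second factor of `Ω × (ℝ≥0 × ℝ≥0)`. -/
def corrVar {Ω : Type*} (ν : Measure ℝ≥0) (ξ : ℕ → Ω → ℝ≥0)
    (g : ℝ≥0 × ℝ≥0 → ℝ) (k : ℕ) (w : Ω × (ℝ≥0 × ℝ≥0)) : ℝ :=
  centered ν g (ξ 1 w.1, w.2.1) * centered ν g (ξ (1 + k) w.1, w.2.2)

/-- `E[g̃ (ξ 1, U) g̃ (ξ (1+k), U')]`, where `U`, `U'` have law `μ` and `U`, `U'`, `ξ` are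
independent. -/
def corr {Ω : Type*} [MeasurableSpace Ω] (P : Measure Ω) (ν μ : Measure ℝ≥0)
    (ξ : ℕ → Ω → ℝ≥0) (g : ℝ≥0 × ℝ≥0 → ℝ) (k : ℕ) : ℝ :=
  ∫ w, corrVar ν ξ g k w ∂(P.prod (μ.prod μ))

/-- The limiting variance `E[g̃ (V, U)²] + 2 ∑_{k ≥ 1} E[g̃ (ξ 1, U) g̃ (ξ (1+k), U')]`, where `V`
has law `ν` and `U` has law `μ`, independent of `V`. -/
def rhoSq {Ω : Type*} [MeasurableSpace Ω] (P : Measure Ω) (ν μ : Measure ℝ≥0)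
    (ξ : ℕ → Ω → ℝ≥0) (g : ℝ≥0 × ℝ≥0 → ℝ) : ℝ :=
  (∫ z, centered ν g z ^ 2 ∂(ν.prod μ)) + 2 * ∑' k : ℕ, corr P ν μ ξ g (k + 1)

end

end QuenchedCLT

/-!
The proof expands the characteristic function of the partial sums one variable at a time, always
towards the past. Together with the covariance inequality for strongly mixing variables this gives
the central limit theorem from the summability of the mixing coefficients alone, so that no
decomposition into blocks is needed.
-/

/-! Fix `s` and put `X k = g̃ (ξ (k+1), s (k+1))`, `S k = X 0 + ⋯ + X (k-1)`, `Y k = exp (i u S k)`.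
Taylor expansion gives `E[Y (k+1)] - E[Y k] ≈ i u E[X k Y k] - (u²/2) E[X k² Y k]`. The linear term
is telescoped along the past: `Y (j+1) - Y j` is `i u X j Y j` plus a remainder of size `u²`
depending only on the variables up to time `j`, so its covariance with the centered `X k` is `O(u²)`
times the mixing coefficient of the gap. These are summable, whence `E[X k Y k] ≈ i u ∑_{j<k} E[X k
X j Y j]`.

Next, `E[X k X j Y j]` is replaced by `E[X k X j] E[Y k]`. At large lags both are small by mixing.
At bounded lags one drops the last `r` factors of `Y j`, which costs `O(r |u|)`, and uses mixing
across the gap. The result is `E[Y (k+1)] = (1 - u² v k) E[Y k] + u² o(1)`, with `v k` half the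
variance increment (`norm_integral_expSum_succ_sub_mul_le`). A discrete Grönwall argument over `N =
O(u⁻²)` steps yields `E[Y N] exp (u² ∑ v k) → 1` (`tendsto_integral_expSum_mul_exp`).

The environment `s` therefore enters the limit only through the average of `v k`. By pair
stationarity this is a sum over lags of averages of a fixed function of two coordinates of `s`. The
strong law applies to each lag, and the covariance bound, uniform in `s`, allows summation over lags
by dominated convergence (`ae_tendsto_average_halfVarIncr`). The exceptional null set does not
depend on `u`, so convergence of characteristic functions holds for almost every `s`. -/

namespace QuenchedCLT

/-! ### Covariance inequality under strong mixing. -/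

section Covariance

variable {Ω : Type*} {mΩ : MeasurableSpace Ω} {P : Measure Ω} [IsProbabilityMeasure P]

lemma norm_integral_smul_le_of_setIntegral_le {E : Type*} [NormedAddCommGroup E] [NormedSpace ℝ E]
    [CompleteSpace E] {m : MeasurableSpace Ω} (hm : m ≤ mΩ) {W : Ω → ℝ} (hW : Integrable W P)
    {Y : Ω → E} (hY : StronglyMeasurable[m] Y) {a c : ℝ} (hYa : ∀ ω, ‖Y ω‖ ≤ a)
    (hc : ∀ S, MeasurableSet[m] S → |∫ ω in S, W ω ∂P| ≤ c) :
    ‖∫ ω, W ω • Y ω ∂P‖ ≤ 2 * a * c := by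
  have ha : 0 ≤ a := by
    obtain ⟨ω⟩ := nonempty_of_isProbabilityMeasure P
    exact (norm_nonneg _).trans (hYa ω)
  have hWY : Integrable (W • Y) P :=
    hW.smul_bdd a (hY.mono hm).aestronglyMeasurable (ae_of_all _ hYa)
  have hpull : P[W • Y | m] =ᵐ[P] P[W | m] • Y :=
    condExp_smul_of_aestronglyMeasurable_right hW hWY hY.aestronglyMeasurable
  have hw : Integrable (P[W | m]) P := integrable_condExp
  have hpos : MeasurableSet[m] {ω | 0 ≤ P[W | m] ω} :=
    stronglyMeasurable_condExp.measurable measurableSet_Ici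
  have hnorm : ∫ ω, ‖P[W | m] ω‖ ∂P ≤ 2 * c := by
    rw [← integral_add_compl (hm _ hpos) hw.norm,
      setIntegral_congr_fun (g := P[W | m]) (hm _ hpos) fun ω hω => Real.norm_of_nonneg hω,
      setIntegral_congr_fun (g := fun ω => -P[W | m] ω) (hm _ hpos.compl)
        fun ω hω => Real.norm_of_nonpos (by simpa using hω : P[W | m] ω < 0).le,
      integral_neg, setIntegral_condExp hm hW hpos, setIntegral_condExp hm hW hpos.compl]
    have h1 := (abs_le.1 (hc _ hpos)).2
    have h2 := (abs_le.1 (hc _ hpos.compl)).1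
    linarith
  calc ‖∫ ω, W ω • Y ω ∂P‖ = ‖∫ ω, P[W | m] ω • Y ω ∂P‖ := by
        congr 1
        exact (integral_condExp hm).symm.trans (integral_congr_ae hpull)
    _ ≤ ∫ ω, ‖P[W | m] ω‖ * a ∂P := by
        refine norm_integral_le_of_norm_le (hw.norm.mul_const a) (ae_of_all _ fun ω => ?_)
        rw [norm_smul]
        exact mul_le_mul_of_nonneg_left (hYa ω) (norm_nonneg _)
    _ ≤ 2 * a * c := by
        rw [integral_mul_const]
        nlinarith

/-- Covariance inequality for bounded variables measurable with respect to two σ-algebras whose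
strong mixing coefficient is at most `α`. -/
lemma norm_integral_smul_sub_le {E : Type*} [NormedAddCommGroup E] [NormedSpace ℝ E]
    [CompleteSpace E] {m₁ m₂ : MeasurableSpace Ω} (h₁ : m₁ ≤ mΩ) (h₂ : m₂ ≤ mΩ) {α a c : ℝ}
    (hα : ∀ A B, MeasurableSet[m₁] A → MeasurableSet[m₂] B →
      |P.real (A ∩ B) - P.real A * P.real B| ≤ α)
    {Y : Ω → E} (hY : StronglyMeasurable[m₁] Y) (hYa : ∀ ω, ‖Y ω‖ ≤ a)
    {Z : Ω → ℝ} (hZ : StronglyMeasurable[m₂] Z) (hZc : ∀ ω, ‖Z ω‖ ≤ c) :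
    ‖∫ ω, Z ω • Y ω ∂P - (∫ ω, Z ω ∂P) • ∫ ω, Y ω ∂P‖ ≤ 4 * a * c * α := by
  have hZi : Integrable Z P :=
    .of_bound (hZ.mono h₂).aestronglyMeasurable c (ae_of_all _ hZc)
  have hYi : Integrable Y P :=
    .of_bound (hY.mono h₁).aestronglyMeasurable a (ae_of_all _ hYa)
  -- The previous lemma is used twice: here with `1_S - P(S)` tested against `Z`, then with `Z -
  -- E[Z]` tested against `Y`. This produces the constant 4.
  have key : ∀ S, MeasurableSet[m₁] S →
      |∫ ω in S, (Z ω - ∫ ω', Z ω' ∂P) ∂P| ≤ 2 * c * α := by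
    intro S hS
    have hSi : Integrable (S.indicator (1 : Ω → ℝ)) P :=
      (integrable_const (1 : ℝ)).indicator (h₁ _ hS)
    have := norm_integral_smul_le_of_setIntegral_le (P := P) (c := α) h₂
      (W := fun ω => S.indicator 1 ω - P.real S) (hSi.sub (integrable_const _)) hZ hZc ?_
    · convert this using 1
      rw [Real.norm_eq_abs]
      congr 1
      rw [integral_sub hZi.integrableOn (integrable_const _).integrableOn, setIntegral_const]
      simp only [smul_eq_mul, sub_mul]
      rw [integral_sub, integral_const_mul]
      · congr 1
        rw [← integral_indicator (h₁ _ hS)]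
        congr 1 with ω
        by_cases h : ω ∈ S <;> simp [h]
      · exact hZi.bdd_mul (c := 1) hSi.aestronglyMeasurable
          (ae_of_all _ fun ω => by by_cases h : ω ∈ S <;> simp [h])
      · exact hZi.const_mul _
    · intro T hT
      rw [integral_sub hSi.integrableOn (integrable_const _).integrableOn, setIntegral_const,
        integral_indicator_one (h₁ _ hS), measureReal_restrict_apply (h₁ _ hS), smul_eq_mul,
        mul_comm (P.real T)]
      exact hα S T hS hT
  have := norm_integral_smul_le_of_setIntegral_le h₁
    (hZi.sub (integrable_const (∫ ω', Z ω' ∂P))) hY hYa key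
  simp only [Pi.sub_apply, sub_smul] at this
  rw [integral_sub, integral_smul] at this
  · linarith
  · exact hZi.smul_bdd a (hY.mono h₁).aestronglyMeasurable (ae_of_all _ hYa)
  · exact hYi.smul _

end Covariance

/-! ### Expansion of the characteristic function along the past, and decoupling. -/

section Mixing

variable {Ω : Type*} {mΩ : MeasurableSpace Ω}

/-- A centered sequence `X` bounded by `K`, where `X k` is measurable with respect to both the past
`F (k + 1)` and the future `G k`, and where `F k` and `G (k + n)` are `b n`-mixing. The past `F 0` is
independent of everything. -/
structure IsBoundedMixing (P : Measure Ω) (X : ℕ → Ω → ℝ) (F G : ℕ → MeasurableSpace Ω)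
    (b : ℕ → ℝ) (K : ℝ) : Prop where
  past_le : ∀ k, F k ≤ mΩ
  past_mono : Monotone F
  future_le : ∀ k, G k ≤ mΩ
  future_anti : Antitone G
  mixing : ∀ k l n, k + n ≤ l ∨ k = 0 → ∀ A B, MeasurableSet[F k] A → MeasurableSet[G l] B →
    |P.real (A ∩ B) - P.real A * P.real B| ≤ b n
  measurable_past : ∀ k, Measurable[F (k + 1)] (X k)
  measurable_future : ∀ k, Measurable[G k] (X k)
  abs_le : ∀ k ω, |X k ω| ≤ K
  integral_eq_zero : ∀ k, ∫ ω, X k ω ∂P = 0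

/-- The random variable `exp (i u (X 0 + ⋯ + X (k - 1)))`. -/
noncomputable def expSum (X : ℕ → Ω → ℝ) (u : ℝ) (k : ℕ) (ω : Ω) : ℂ :=
  Complex.exp ((u * ∑ j ∈ Finset.range k, X j ω : ℝ) * Complex.I)

/-- Half the increment of the variance of the partial sums of `X` at time `k`. -/
noncomputable def halfVarIncr (P : Measure Ω) (X : ℕ → Ω → ℝ) (k : ℕ) : ℝ :=
  (∫ ω, X k ω * X k ω ∂P) / 2 + ∑ j ∈ Finset.range k, ∫ ω, X k ω * X j ω ∂P

lemma norm_expSum (X : ℕ → Ω → ℝ) (u : ℝ) (k : ℕ) (ω : Ω) : ‖expSum X u k ω‖ = 1 :=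
  Complex.norm_exp_ofReal_mul_I _

lemma expSum_zero (X : ℕ → Ω → ℝ) (u : ℝ) (ω : Ω) : expSum X u 0 ω = 1 := by
  simp [expSum]

lemma expSum_succ (X : ℕ → Ω → ℝ) (u : ℝ) (k : ℕ) (ω : Ω) :
    expSum X u (k + 1) ω = expSum X u k ω * Complex.exp ((u * X k ω : ℝ) * Complex.I) := by
  rw [expSum, expSum, ← Complex.exp_add, Finset.sum_range_succ]
  push_cast
  ring_nf

lemma norm_exp_mul_I_sub_taylor_one_le {x : ℝ} (hx : |x| ≤ 1) :
    ‖Complex.exp (x * Complex.I) - 1 - x * Complex.I‖ ≤ |x| ^ 2 := by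
  simpa using Complex.norm_exp_sub_one_sub_id_le (x := x * Complex.I) (by simpa using hx)

lemma norm_exp_mul_I_sub_taylor_two_le {x : ℝ} (hx : |x| ≤ 1) :
    ‖Complex.exp (x * Complex.I) - 1 - x * Complex.I + x ^ 2 / 2‖ ≤ |x| ^ 3 := by
  have := Complex.exp_bound (x := x * Complex.I) (by simpa using hx) (n := 3) (by norm_num)
  simp only [Finset.sum_range_succ, Finset.sum_range_zero, norm_mul, Complex.norm_real,
    Complex.norm_I, mul_pow, Complex.I_sq, Real.norm_eq_abs, Nat.factorial] at this
  norm_num at this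
  have h3 : 0 ≤ |x| ^ 3 := by positivity
  refine le_trans (le_of_eq ?_) (this.trans (by linarith))
  congr 1
  ring

variable {P : Measure Ω} {X : ℕ → Ω → ℝ} {F G : ℕ → MeasurableSpace Ω}
  {b : ℕ → ℝ} {K : ℝ}

namespace IsBoundedMixing

lemma coeff_nonneg (h : IsBoundedMixing P X F G b K) (n : ℕ) : 0 ≤ b n :=
  (abs_nonneg _).trans
    (h.mixing 0 0 n (.inr rfl) ∅ ∅ (@MeasurableSet.empty _ (F 0)) (@MeasurableSet.empty _ (G 0)))

lemma measurable (h : IsBoundedMixing P X F G b K) (k : ℕ) : Measurable (X k) :=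
  (h.measurable_past k).mono (h.past_le _) le_rfl

lemma measurable_expSum (h : IsBoundedMixing P X F G b K) (u : ℝ) (k : ℕ) :
    Measurable[F k] (expSum X u k) := by
  have hX : ∀ j ∈ Finset.range k, Measurable[F k] (X j) := fun j hj =>
    (h.measurable_past j).mono (h.past_mono (Finset.mem_range.1 hj)) le_rfl
  have hS : Measurable[F k] (fun ω => ∑ j ∈ Finset.range k, X j ω) :=
    @Finset.measurable_fun_sum ℝ ℕ Ω _ _ _ (F k) _ _ hX
  exact Complex.measurable_exp.comp
    ((Complex.measurable_ofReal.comp (hS.const_mul u)).mul_const Complex.I)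

lemma norm_expSum_add_sub_le (h : IsBoundedMixing P X F G b K) (u : ℝ) (k n : ℕ) (ω : Ω) :
    ‖expSum X u (k + n) ω - expSum X u k ω‖ ≤ |u| * K * n := by
  induction n with
  | zero => simp
  | succ n ih =>
    have h1 : ‖expSum X u (k + n + 1) ω - expSum X u (k + n) ω‖ ≤ |u| * K := by
      rw [expSum_succ, ← mul_sub_one, norm_mul, norm_expSum, one_mul, mul_comm _ Complex.I]
      refine Real.norm_exp_I_mul_ofReal_sub_one_le.trans ?_
      rw [Real.norm_eq_abs, abs_mul]
      exact mul_le_mul_of_nonneg_left (h.abs_le _ ω) (abs_nonneg u)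
    calc _ ≤ ‖expSum X u (k + n + 1) ω - expSum X u (k + n) ω‖
          + ‖expSum X u (k + n) ω - expSum X u k ω‖ := norm_sub_le_norm_sub_add_norm_sub _ _ _
      _ ≤ |u| * K + |u| * K * n := add_le_add h1 ih
      _ = _ := by push_cast; ring

variable [IsProbabilityMeasure P]

lemma bound_nonneg (h : IsBoundedMixing P X F G b K) : 0 ≤ K := by
  obtain ⟨ω⟩ := nonempty_of_isProbabilityMeasure P
  exact (abs_nonneg _).trans (h.abs_le 0 ω)

lemma norm_cov_le {E : Type*} [NormedAddCommGroup E] [NormedSpace ℝ E] [CompleteSpace E]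
    (h : IsBoundedMixing P X F G b K) {k l n : ℕ} (hkl : k + n ≤ l ∨ k = 0) {Y : Ω → E} {Z : Ω → ℝ}
    {a c : ℝ} (hY : StronglyMeasurable[F k] Y) (hYa : ∀ ω, ‖Y ω‖ ≤ a) (hZ : Measurable[G l] Z)
    (hZc : ∀ ω, |Z ω| ≤ c) :
    ‖∫ ω, Z ω • Y ω ∂P - (∫ ω, Z ω ∂P) • ∫ ω, Y ω ∂P‖ ≤ 4 * a * c * b n :=
  norm_integral_smul_sub_le (h.past_le k) (h.future_le l) (h.mixing k l n hkl) hY hYa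
    hZ.stronglyMeasurable hZc

lemma integrable_expSum (h : IsBoundedMixing P X F G b K) (u : ℝ) (k : ℕ) :
    Integrable (expSum X u k) P :=
  .of_bound ((h.measurable_expSum u k).mono (h.past_le k) le_rfl).aestronglyMeasurable 1
    (ae_of_all _ fun ω => (norm_expSum X u k ω).le)

lemma integrable_smul_expSum (h : IsBoundedMixing P X F G b K) (u : ℝ) (k j : ℕ) :
    Integrable (fun ω => X k ω • expSum X u j ω) P :=
  (h.integrable_expSum u j).bdd_smul K (h.measurable k).aestronglyMeasurable
    (ae_of_all _ (h.abs_le k))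

lemma abs_mul_le (h : IsBoundedMixing P X F G b K) (k j : ℕ) (ω : Ω) :
    |X k ω * X j ω| ≤ K ^ 2 := by
  rw [abs_mul, sq]
  exact mul_le_mul (h.abs_le k ω) (h.abs_le j ω) (abs_nonneg _) h.bound_nonneg

lemma integrable_mul_smul_expSum (h : IsBoundedMixing P X F G b K) (u : ℝ) (k j i : ℕ) :
    Integrable (fun ω => (X k ω * X j ω) • expSum X u i ω) P :=
  (h.integrable_expSum u i).bdd_smul (K ^ 2)
    ((h.measurable k).mul (h.measurable j)).aestronglyMeasurable (ae_of_all _ (h.abs_mul_le k j))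

lemma norm_integral_expSum_le (u : ℝ) (k : ℕ) : ‖∫ ω, expSum X u k ω ∂P‖ ≤ 1 := by
  simpa using norm_integral_le_of_norm_le_const (μ := P)
    (ae_of_all P fun ω => (norm_expSum X u k ω).le)

/-- Second order expansion of the increment of the characteristic function. -/
lemma norm_integral_expSum_succ_sub_le (h : IsBoundedMixing P X F G b K) {u : ℝ}
    (hu : |u| * K ≤ 1) (k : ℕ) :
    ‖∫ ω, expSum X u (k + 1) ω ∂P - ∫ ω, expSum X u k ω ∂P
      - (u * Complex.I) * ∫ ω, X k ω • expSum X u k ω ∂P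
      + (u ^ 2 / 2) * ∫ ω, (X k ω * X k ω) • expSum X u k ω ∂P‖ ≤ (|u| * K) ^ 3 := by
  rw [← integral_sub (h.integrable_expSum u _) (h.integrable_expSum u _), ← integral_const_mul,
    ← integral_const_mul, ← integral_sub, ← integral_add]
  rotate_left
  · exact ((h.integrable_expSum u _).sub (h.integrable_expSum u _)).sub
      ((h.integrable_smul_expSum u k k).const_mul _)
  · exact (h.integrable_mul_smul_expSum u k k k).const_mul _
  · exact (h.integrable_expSum u _).sub (h.integrable_expSum u _)
  · exact (h.integrable_smul_expSum u k k).const_mul _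
  refine (norm_integral_le_of_norm_le_const (C := (|u| * K) ^ 3)
    (ae_of_all P fun ω => ?_)).trans (by simp)
  have hux : |u * X k ω| ≤ |u| * K := by
    rw [abs_mul]; exact mul_le_mul_of_nonneg_left (h.abs_le _ ω) (abs_nonneg u)
  refine le_trans (le_of_eq ?_) ((norm_exp_mul_I_sub_taylor_two_le (hux.trans hu)).trans
    (pow_le_pow_left₀ (abs_nonneg _) hux 3))
  have e := norm_mul (expSum X u k ω) (Complex.exp ((u * X k ω : ℝ) * Complex.I) - 1
    - (u * X k ω : ℝ) * Complex.I + ((u * X k ω : ℝ) : ℂ) ^ 2 / 2)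
  rw [norm_expSum, one_mul] at e
  rw [← e, expSum_succ]
  simp only [Complex.real_smul]
  push_cast
  ring_nf

/-- Expansion of `E[X k Y k]` along the past, where `Y k = expSum X u k`. -/
lemma norm_integral_smul_expSum_sub_le (h : IsBoundedMixing P X F G b K) {u : ℝ}
    (hu : |u| * K ≤ 1) (k : ℕ) :
    ‖∫ ω, X k ω • expSum X u k ω ∂P
      - (u * Complex.I) * ∑ j ∈ Finset.range k, ∫ ω, (X k ω * X j ω) • expSum X u j ω ∂P‖
      ≤ 4 * (|u| * K) ^ 2 * K * ∑ i ∈ Finset.range k, b i := by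
  -- The telescoping ends at `Y 0 = 1`, whose contribution vanishes because `X k` is centered.
  have htel : ∫ ω, X k ω • expSum X u k ω ∂P = ∑ j ∈ Finset.range k,
      (∫ ω, X k ω • expSum X u (j + 1) ω ∂P - ∫ ω, X k ω • expSum X u j ω ∂P) := by
    rw [Finset.sum_range_sub fun j => ∫ ω, X k ω • expSum X u j ω ∂P]
    have : ∫ ω, X k ω • expSum X u 0 ω ∂P = 0 := by
      simp_rw [expSum_zero]
      rw [integral_smul_const, h.integral_eq_zero, zero_smul]
    rw [this, sub_zero]
  rw [htel, Finset.mul_sum, ← Finset.sum_sub_distrib, ← Finset.sum_range_reflect b k,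
    Finset.mul_sum]
  refine norm_sum_le_of_le _ fun j hj => ?_
  have hjk := Finset.mem_range.1 hj
  rw [← integral_sub (h.integrable_smul_expSum u _ _) (h.integrable_smul_expSum u _ _),
    ← integral_const_mul, ← integral_sub]
  rotate_left
  · exact (h.integrable_smul_expSum u _ _).sub (h.integrable_smul_expSum u _ _)
  · exact (h.integrable_mul_smul_expSum u _ _ _).const_mul _
  have hmeas : Measurable[F (j + 1)] (fun ω => expSum X u (j + 1) ω - expSum X u j ω
      - (u * Complex.I) * (X j ω * expSum X u j ω)) := by
    have h1 := h.measurable_expSum u (j + 1)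
    have h2 := (h.measurable_expSum u j).mono (h.past_mono j.le_succ) le_rfl
    have h3 := h.measurable_past j
    exact (h1.sub h2).sub (((Complex.measurable_ofReal.comp h3).mul h2).const_mul _)
  have hbd : ∀ ω, ‖expSum X u (j + 1) ω - expSum X u j ω
      - (u * Complex.I) * (X j ω * expSum X u j ω)‖ ≤ (|u| * K) ^ 2 := by
    intro ω
    have hux : |u * X j ω| ≤ |u| * K := by
      rw [abs_mul]; exact mul_le_mul_of_nonneg_left (h.abs_le _ ω) (abs_nonneg u)
    refine le_trans (le_of_eq ?_) ((norm_exp_mul_I_sub_taylor_one_le (hux.trans hu)).trans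
      (pow_le_pow_left₀ (abs_nonneg _) hux 2))
    have e := norm_mul (expSum X u j ω) (Complex.exp ((u * X j ω : ℝ) * Complex.I) - 1
      - (u * X j ω : ℝ) * Complex.I)
    rw [norm_expSum, one_mul] at e
    rw [← e, expSum_succ]
    push_cast
    ring_nf
  -- The first order remainder lies in `F (j + 1)`, so the gap to `X k` is `k - 1 - j`.
  have hcov := h.norm_cov_le (k := j + 1) (l := k) (n := k - 1 - j) (.inl (by omega))
    hmeas.stronglyMeasurable hbd (h.measurable_future k) (h.abs_le k)
  rw [h.integral_eq_zero, zero_smul, sub_zero] at hcov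
  refine le_trans (le_of_eq ?_) hcov
  congr 2 with ω
  simp only [Complex.real_smul]
  push_cast
  ring

lemma abs_integral_mul_le (h : IsBoundedMixing P X F G b K) {j k : ℕ} (hjk : j < k) :
    |∫ ω, X k ω * X j ω ∂P| ≤ 4 * K ^ 2 * b (k - 1 - j) := by
  have := h.norm_cov_le (k := j + 1) (l := k) (n := k - 1 - j) (.inl (by omega))
    (h.measurable_past j).stronglyMeasurable (h.abs_le j) (h.measurable_future k) (h.abs_le k)
  rw [h.integral_eq_zero, zero_smul, sub_zero] at this
  simp only [smul_eq_mul, Real.norm_eq_abs] at this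
  linarith

/-- Decoupling error bounded by the mixing coefficient of the gap between `j` and `k`. -/
lemma norm_decoupling_le_of_lt (h : IsBoundedMixing P X F G b K) (u : ℝ) {j k : ℕ} (hjk : j < k) :
    ‖∫ ω, (X k ω * X j ω) • expSum X u j ω ∂P
      - (∫ ω, X k ω * X j ω ∂P : ℝ) * ∫ ω, expSum X u k ω ∂P‖ ≤ 8 * K ^ 2 * b (k - 1 - j) := by
  have hmeas : Measurable[F (j + 1)] (fun ω => X j ω • expSum X u j ω) := by
    have h2 := (h.measurable_expSum u j).mono (h.past_mono j.le_succ) le_rfl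
    exact (h.measurable_past j).smul h2
  have hcov := h.norm_cov_le (k := j + 1) (l := k) (n := k - 1 - j) (a := K) (.inl (by omega))
    hmeas.stronglyMeasurable
    (fun ω => by rw [norm_smul, norm_expSum, mul_one]; exact h.abs_le j ω)
    (h.measurable_future k) (h.abs_le k)
  rw [h.integral_eq_zero, zero_smul, sub_zero] at hcov
  simp_rw [← mul_smul] at hcov
  -- No cancellation is needed: each of the two terms is at most `4 K² b (k-1-j)`.
  have h2 : ‖(∫ ω, X k ω * X j ω ∂P : ℝ) * ∫ ω, expSum X u k ω ∂P‖
      ≤ 4 * K ^ 2 * b (k - 1 - j) * 1 := by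
    rw [norm_mul, Complex.norm_real]
    exact mul_le_mul (h.abs_integral_mul_le hjk) (norm_integral_expSum_le u k) (norm_nonneg _)
      ((abs_nonneg _).trans (h.abs_integral_mul_le hjk))
  refine (norm_sub_le _ _).trans ?_
  linarith

/-- Decoupling error obtained by removing the last `r` variables before time `j`. -/
lemma norm_decoupling_le (h : IsBoundedMixing P X F G b K) (u : ℝ) {j k : ℕ} (hjk : j ≤ k) (r : ℕ) :
    ‖∫ ω, (X k ω * X j ω) • expSum X u j ω ∂P
      - (∫ ω, X k ω * X j ω ∂P : ℝ) * ∫ ω, expSum X u k ω ∂P‖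
      ≤ 4 * K ^ 2 * b r + K ^ 3 * |u| * ((k - j : ℕ) + 2 * r) := by
  have hK := h.bound_nonneg
  -- If `r > j`, truncated subtraction gives time 0, which is the case `k = 0` allowed in `mixing`.
  have hcov := h.norm_cov_le (k := j - r) (l := j) (n := r) (by omega)
    (h.measurable_expSum u (j - r)).stronglyMeasurable (fun ω => (norm_expSum X u _ ω).le)
    (((h.measurable_future k).mono (h.future_anti hjk) le_rfl).mul (h.measurable_future j))
    (h.abs_mul_le k j)
  have hdiff : ∀ i l, i ≤ l → ∀ ω, ‖expSum X u l ω - expSum X u i ω‖ ≤ |u| * K * (l - i : ℕ) := by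
    intro i l hil ω
    obtain ⟨n, rfl⟩ := Nat.exists_eq_add_of_le hil
    simpa using h.norm_expSum_add_sub_le u i n ω
  have h1 : ‖∫ ω, (X k ω * X j ω) • expSum X u j ω ∂P
      - ∫ ω, (X k ω * X j ω) • expSum X u (j - r) ω ∂P‖ ≤ K ^ 2 * (|u| * K * r) := by
    rw [← integral_sub (h.integrable_mul_smul_expSum u _ _ _)
      (h.integrable_mul_smul_expSum u _ _ _)]
    refine (norm_integral_le_of_norm_le_const (C := K ^ 2 * (|u| * K * r))
      (ae_of_all P fun ω => ?_)).trans (by simp)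
    rw [← smul_sub, norm_smul]
    refine mul_le_mul (h.abs_mul_le k j ω) ((hdiff _ _ (Nat.sub_le j r) ω).trans ?_)
      (norm_nonneg _) (by positivity)
    gcongr
    omega
  have h2 : ‖(∫ ω, X k ω * X j ω ∂P) • ∫ ω, expSum X u (j - r) ω ∂P
      - (∫ ω, X k ω * X j ω ∂P : ℝ) * ∫ ω, expSum X u k ω ∂P‖
      ≤ K ^ 2 * (|u| * K * ((k - j : ℕ) + r)) := by
    rw [Complex.real_smul, ← mul_sub, norm_mul, norm_sub_rev, Complex.norm_real]
    refine mul_le_mul ?_ ?_ (norm_nonneg _) (by positivity)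
    · simpa using norm_integral_le_of_norm_le_const (μ := P) (f := fun ω => X k ω * X j ω)
        (ae_of_all P (h.abs_mul_le k j))
    · rw [← integral_sub (h.integrable_expSum u _) (h.integrable_expSum u _)]
      refine (norm_integral_le_of_norm_le_const (C := |u| * K * ((k - j : ℕ) + r))
        (ae_of_all P fun ω => (hdiff _ _ (by omega) ω).trans ?_)).trans (by simp)
      gcongr
      exact_mod_cast (by omega : k - (j - r) ≤ k - j + r)
  have h3 := norm_sub_le_norm_sub_add_norm_sub
    (∫ ω, (X k ω * X j ω) • expSum X u j ω ∂P) (∫ ω, (X k ω * X j ω) • expSum X u (j - r) ω ∂P)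
    ((∫ ω, X k ω * X j ω ∂P : ℝ) * ∫ ω, expSum X u k ω ∂P)
  have h4 := norm_sub_le_norm_sub_add_norm_sub
    (∫ ω, (X k ω * X j ω) • expSum X u (j - r) ω ∂P)
    ((∫ ω, X k ω * X j ω ∂P) • ∫ ω, expSum X u (j - r) ω ∂P)
    ((∫ ω, X k ω * X j ω ∂P : ℝ) * ∫ ω, expSum X u k ω ∂P)
  refine h3.trans ((add_le_add h1 (h4.trans (add_le_add hcov h2))).trans (le_of_eq ?_))
  ring

end IsBoundedMixing

end Mixing

/-! ### From the one-step recursion to the asymptotics of the characteristic function. -/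

section CharFun

variable {Ω : Type*} {mΩ : MeasurableSpace Ω} {P : Measure Ω} [IsProbabilityMeasure P]
  {X : ℕ → Ω → ℝ} {F G : ℕ → MeasurableSpace Ω} {b : ℕ → ℝ} {K : ℝ}

/-- At most `M` indices have lag below `M`, and the others are controlled by the tail of `b`; the
bound is uniform in `k`. -/
lemma sum_range_le_of_head_tail {f : ℕ → ℝ} {b : ℕ → ℝ} (hb : Summable b) (hb0 : ∀ n, 0 ≤ b n)
    {c d : ℝ} (hc : 0 ≤ c) (hd : 0 ≤ d) (M k : ℕ) (hhead : ∀ j < k, k - 1 - j < M → f j ≤ c)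
    (htail : ∀ j < k, f j ≤ d * b (k - 1 - j)) :
    ∑ j ∈ Finset.range k, f j ≤ M * c + d * ∑' i, b (M + i) := by
  let φ : ℕ → ℝ := fun i => if i < M then c else d * b i
  have hφ : ∀ i, 0 ≤ φ i := fun i => by
    by_cases hi : i < M
    · simp [φ, hi, hc]
    · simpa [φ, hi] using mul_nonneg hd (hb0 i)
  have hbM : Summable fun i => b (M + i) := by
    simpa only [add_comm M] using (summable_nat_add_iff M).2 hb
  calc ∑ j ∈ Finset.range k, f j ≤ ∑ j ∈ Finset.range k, φ (k - 1 - j) := by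
        refine Finset.sum_le_sum fun j hj => ?_
        have hj := Finset.mem_range.1 hj
        by_cases hi : k - 1 - j < M
        · simpa [φ, hi] using hhead j hj hi
        · simpa [φ, hi] using htail j hj
    _ = ∑ i ∈ Finset.range k, φ i := Finset.sum_range_reflect φ k
    _ ≤ ∑ i ∈ Finset.range (M + k), φ i :=
        Finset.sum_le_sum_of_subset_of_nonneg (Finset.range_mono (by omega)) fun i _ _ => hφ i
    _ = M * c + d * ∑ i ∈ Finset.range k, b (M + i) := by
        rw [Finset.sum_range_add, Finset.mul_sum]
        congr 1
        · rw [Finset.sum_congr rfl (g := fun _ => c)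
            fun i hi => by simp [φ, Finset.mem_range.1 hi]]
          simp
        · exact Finset.sum_congr rfl fun i _ => by simp [φ]
    _ ≤ M * c + d * ∑' i, b (M + i) := by
        gcongr
        exact hbM.sum_le_tsum _ fun i _ => hb0 _

/-- Bound for the decoupling errors, with mixing truncated at lag `M` and a gap of length `r`. -/
noncomputable def decouplingBound (b : ℕ → ℝ) (K u : ℝ) (M r : ℕ) : ℝ :=
  (M + 1) * (4 * K ^ 2 * b r + K ^ 3 * |u| * (M + 2 * r)) + 8 * K ^ 2 * ∑' i, b (M + i)

/-- The order of choice matters: `M` makes the tail small, then `r` absorbs the factor `M + 1`.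
Taking `u = 0` suffices, since the bound is continuous in `u`. -/
lemma exists_decouplingBound_lt {b : ℕ → ℝ} {K : ℝ} (hb : Summable b) {ε : ℝ} (hε : 0 < ε) :
    ∃ M r, decouplingBound b K 0 M r < ε := by
  have h1 : Tendsto (fun M => 8 * K ^ 2 * ∑' i, b (M + i)) atTop (𝓝 0) := by
    simpa [add_comm] using (tendsto_sum_nat_add b).const_mul (8 * K ^ 2)
  obtain ⟨M, hM⟩ := (h1.eventually (gt_mem_nhds (half_pos hε))).exists
  have h2 : Tendsto (fun r => ((M : ℝ) + 1) * (4 * K ^ 2 * b r)) atTop (𝓝 0) := by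
    simpa using (hb.tendsto_atTop_zero.const_mul (4 * K ^ 2)).const_mul ((M : ℝ) + 1)
  obtain ⟨r, hr⟩ := (h2.eventually (gt_mem_nhds (half_pos hε))).exists
  refine ⟨M, r, ?_⟩
  simp only [decouplingBound, abs_zero, mul_zero, zero_mul, add_zero]
  linarith

namespace IsBoundedMixing

/-- One-step recursion: the two expansions contribute the cubic error, and decoupling contributes
`u²` times a quantity that can be made arbitrarily small. -/
lemma norm_integral_expSum_succ_sub_mul_le (h : IsBoundedMixing P X F G b K) (hb : Summable b)
    {u : ℝ} (hu : |u| * K ≤ 1) (k M r : ℕ) :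
    ‖∫ ω, expSum X u (k + 1) ω ∂P
      - (1 - u ^ 2 * halfVarIncr P X k : ℝ) * ∫ ω, expSum X u k ω ∂P‖
      ≤ |u| ^ 3 * (K ^ 3 * (1 + 4 * ∑' i, b i)) + u ^ 2 * decouplingBound b K u M r := by
  have hK := h.bound_nonneg
  let e : ℕ → ℂ := fun j => ∫ ω, (X k ω * X j ω) • expSum X u j ω ∂P
      - (∫ ω, X k ω * X j ω ∂P : ℝ) * ∫ ω, expSum X u k ω ∂P
  let c : ℝ := 4 * K ^ 2 * b r + K ^ 3 * |u| * (M + 2 * r)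
  have hc : 0 ≤ c := by
    have := h.coeff_nonneg r
    positivity
  have hsum : ∑ j ∈ Finset.range k, ‖e j‖ ≤ M * c + 8 * K ^ 2 * ∑' i, b (M + i) := by
    refine sum_range_le_of_head_tail hb h.coeff_nonneg hc (by positivity) M k ?_ ?_
    · intro j hj hM
      refine (h.norm_decoupling_le u hj.le r).trans ?_
      simp only [c]
      gcongr
      omega
    · exact fun j hj => h.norm_decoupling_le_of_lt u hj
  have hdiag : ‖e k‖ ≤ c := by
    refine (h.norm_decoupling_le u le_rfl r).trans ?_
    simp only [c, Nat.sub_self, Nat.cast_zero]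
    gcongr
    exact Nat.cast_nonneg M
  have herr : ‖e k / 2 + ∑ j ∈ Finset.range k, e j‖ ≤ decouplingBound b K u M r := by
    refine (norm_add_le _ _).trans ?_
    rw [norm_div, Complex.norm_ofNat]
    have := norm_sum_le (Finset.range k) e
    have hd : decouplingBound b K u M r = (M + 1) * c + 8 * K ^ 2 * ∑' i, b (M + i) := rfl
    rw [hd]
    linarith
  have hA := h.norm_integral_expSum_succ_sub_le hu k
  have hB := h.norm_integral_smul_expSum_sub_le hu k
  have hBs : ∑ i ∈ Finset.range k, b i ≤ ∑' i, b i := hb.sum_le_tsum _ fun i _ => h.coeff_nonneg i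
  set A := ∫ ω, expSum X u (k + 1) ω ∂P - ∫ ω, expSum X u k ω ∂P
      - (u * Complex.I) * ∫ ω, X k ω • expSum X u k ω ∂P
      + (u ^ 2 / 2) * ∫ ω, (X k ω * X k ω) • expSum X u k ω ∂P with hAdef
  set B := ∫ ω, X k ω • expSum X u k ω ∂P
      - (u * Complex.I) * ∑ j ∈ Finset.range k, ∫ ω, (X k ω * X j ω) • expSum X u j ω ∂P with hBdef
  have hsplit : ∫ ω, expSum X u (k + 1) ω ∂P
      - (1 - u ^ 2 * halfVarIncr P X k : ℝ) * ∫ ω, expSum X u k ω ∂P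
      -- Substituting the expansion of `E[X k Y k]` turns `(i u)²` into `-u²`, which supplies the
      -- off-diagonal part of `halfVarIncr`.
      = A + (u * Complex.I) * B - u ^ 2 * (e k / 2 + ∑ j ∈ Finset.range k, e j) := by
    simp only [e, hAdef, hBdef, halfVarIncr, Finset.sum_sub_distrib, ← Finset.sum_mul]
    push_cast
    linear_combination ((u : ℂ) ^ 2 *
      ∑ j ∈ Finset.range k, ∫ ω, (X k ω * X j ω) • expSum X u j ω ∂P) * Complex.I_sq
  rw [hsplit]
  refine (norm_sub_le _ _).trans ((add_le_add_left (norm_add_le _ _) _).trans ?_)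
  simp only [norm_mul, norm_pow, Complex.norm_real, Complex.norm_I, mul_one, Real.norm_eq_abs,
    sq_abs]
  have h1 : |u| * ‖B‖ ≤ |u| * (4 * (|u| * K) ^ 2 * K * ∑' i, b i) := by
    gcongr
    exact hB.trans (by gcongr)
  have h2 := mul_le_mul_of_nonneg_left herr (sq_nonneg u)
  calc _ ≤ (|u| * K) ^ 3 + |u| * (4 * (|u| * K) ^ 2 * K * ∑' i, b i)
        + u ^ 2 * decouplingBound b K u M r := by gcongr
    _ = _ := by ring

lemma abs_halfVarIncr_le (h : IsBoundedMixing P X F G b K) (hb : Summable b) (k : ℕ) :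
    |halfVarIncr P X k| ≤ K ^ 2 * (1 + 4 * ∑' i, b i) := by
  have h1 : |∫ ω, X k ω * X k ω ∂P| ≤ K ^ 2 := by
    simpa using norm_integral_le_of_norm_le_const (μ := P) (f := fun ω => X k ω * X k ω)
      (ae_of_all P (h.abs_mul_le k k))
  have h2 := sum_range_le_of_head_tail (f := fun j => |∫ ω, X k ω * X j ω ∂P|) hb h.coeff_nonneg
    le_rfl (by positivity : 0 ≤ 4 * K ^ 2) 0 k (by simp) fun j hj => h.abs_integral_mul_le hj
  have h3 := Finset.abs_sum_le_sum_abs (fun j => ∫ ω, X k ω * X j ω ∂P) (Finset.range k)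
  rw [halfVarIncr]
  refine (abs_add_le _ _).trans ?_
  rw [abs_div, abs_two]
  simp only [zero_add, Nat.cast_zero, zero_mul] at h2
  nlinarith [sq_nonneg K]

end IsBoundedMixing

/-- A discrete Grönwall estimate. -/
lemma norm_mul_exp_sum_sub_le {y : ℕ → ℂ} {v : ℕ → ℝ} {C δ : ℝ} {N : ℕ} (hy : ∀ k, ‖y k‖ ≤ 1)
    (hC : C ≤ 1) (hv : ∀ k, |v k| ≤ C) (hstep : ∀ k, ‖y (k + 1) - (1 - v k : ℝ) * y k‖ ≤ δ) :
    ‖y N * Real.exp (∑ k ∈ Finset.range N, v k) - y 0‖ ≤ N * Real.exp (N * C) * (δ + C ^ 2) := by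
  -- With this integrating factor, each increment consists of the recursion error and of `exp (-v) -
  -- 1 + v = O(v²)`.
  let z : ℕ → ℂ := fun n => y n * Real.exp (∑ k ∈ Finset.range n, v k)
  have hC0 : 0 ≤ C := (abs_nonneg _).trans (hv 0)
  have hδ : 0 ≤ δ := (norm_nonneg _).trans (hstep 0)
  have hz : z N - z 0 = ∑ n ∈ Finset.range N, (z (n + 1) - z n) := (Finset.sum_range_sub z N).symm
  have hz0 : z 0 = y 0 := by simp [z]
  change ‖z N - y 0‖ ≤ _
  rw [← hz0, hz]
  refine (norm_sum_le_of_le (f := fun n => z (n + 1) - z n)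
    (n := fun _ => Real.exp (N * C) * (δ + C ^ 2)) _ fun n hn => ?_).trans
    (le_of_eq (by simp [mul_assoc]))
  have hn := Finset.mem_range.1 hn
  have hfac : z (n + 1) - z n = Real.exp (∑ k ∈ Finset.range (n + 1), v k) *
      (y (n + 1) - (1 - v n : ℝ) * y n - (Real.exp (-v n) - 1 - (-v n) : ℝ) * y n) := by
    simp only [z, Finset.sum_range_succ]
    have : Real.exp (∑ k ∈ Finset.range n, v k)
        = Real.exp (∑ k ∈ Finset.range n, v k + v n) * Real.exp (-v n) := by
      rw [← Real.exp_add]; ring_nf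
    rw [this]
    push_cast
    ring
  rw [hfac, norm_mul, Complex.norm_real, Real.norm_of_nonneg (Real.exp_pos _).le]
  refine mul_le_mul (Real.exp_le_exp.2 ?_) ((norm_sub_le _ _).trans (add_le_add (hstep n) ?_))
    (norm_nonneg _) (Real.exp_pos _).le
  · calc ∑ k ∈ Finset.range (n + 1), v k ≤ ∑ k ∈ Finset.range (n + 1), C :=
          Finset.sum_le_sum fun k _ => (le_abs_self _).trans (hv k)
      _ ≤ N * C := by
          rw [Finset.sum_const, Finset.card_range, nsmul_eq_mul]
          gcongr
          exact_mod_cast hn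
  · rw [norm_mul, Complex.norm_real]
    have h1 := Real.norm_exp_sub_one_sub_id_le (x := -v n)
      (by rw [norm_neg]; exact (hv n).trans hC)
    have h2 : ‖-v n‖ ^ 2 ≤ C ^ 2 := by
      rw [norm_neg]; exact pow_le_pow_left₀ (norm_nonneg _) (hv n) 2
    calc _ ≤ C ^ 2 * 1 := mul_le_mul (h1.trans h2) (hy n) (norm_nonneg _) (sq_nonneg C)
      _ = C ^ 2 := mul_one _

namespace IsBoundedMixing

lemma decouplingBound_nonneg (h : IsBoundedMixing P X F G b K) (u : ℝ) (M r : ℕ) :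
    0 ≤ decouplingBound b K u M r := by
  have h1 := h.coeff_nonneg r
  have h2 : 0 ≤ ∑' i, b (M + i) := tsum_nonneg fun i => h.coeff_nonneg _
  have h3 := h.bound_nonneg
  rw [decouplingBound]
  positivity

/-- For bounded sequences with summable mixing coefficients, the characteristic function of the
partial sum of `N` terms at `u` is asymptotic to that of a centered Gaussian with the same
variance, as `u → 0` with `N u²` bounded. -/
theorem tendsto_integral_expSum_mul_exp (h : IsBoundedMixing P X F G b K) (hb : Summable b)
    {N : ℕ → ℕ} {u : ℕ → ℝ} {T : ℝ} (hu : Tendsto u atTop (𝓝 0))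
    (hNu : ∀ n, N n * u n ^ 2 ≤ T) :
    Tendsto (fun n => (∫ ω, expSum X (u n) (N n) ω ∂P) *
      Real.exp (∑ k ∈ Finset.range (N n), u n ^ 2 * halfVarIncr P X k)) atTop (𝓝 1) := by
  have hT : 0 ≤ T := le_trans (by positivity) (hNu 0)
  have hK := h.bound_nonneg
  set D : ℝ := 1 + 4 * ∑' i, b i with hD
  have hD0 : 0 ≤ D := by
    have : 0 ≤ ∑' i, b i := tsum_nonneg h.coeff_nonneg
    positivity
  have hbound : ∀ M r n, |u n| * K ≤ 1 → u n ^ 2 * (K ^ 2 * D) ≤ 1 →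
      ‖(∫ ω, expSum X (u n) (N n) ω ∂P) *
        Real.exp (∑ k ∈ Finset.range (N n), u n ^ 2 * halfVarIncr P X k) - 1‖ ≤
      T * Real.exp (T * (K ^ 2 * D)) *
        (|u n| * (K ^ 3 * D) + decouplingBound b K (u n) M r + u n ^ 2 * (K ^ 2 * D) ^ 2) := by
    intro M r n hu1 hu2
    have hdec := h.decouplingBound_nonneg (u n) M r
    have hG := norm_mul_exp_sum_sub_le (y := fun k => ∫ ω, expSum X (u n) k ω ∂P)
      (v := fun k => u n ^ 2 * halfVarIncr P X k) (C := u n ^ 2 * (K ^ 2 * D)) (N := N n)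
      (fun k => norm_integral_expSum_le (u n) k) hu2
      (fun k => by
        rw [abs_mul, abs_of_nonneg (sq_nonneg (u n))]
        exact mul_le_mul_of_nonneg_left (h.abs_halfVarIncr_le hb k) (sq_nonneg _))
      (fun k => h.norm_integral_expSum_succ_sub_mul_le hb hu1 k M r)
    have h0 : ∫ ω, expSum X (u n) 0 ω ∂P = 1 := by simp [expSum_zero]
    simp only [h0] at hG
    refine hG.trans ?_
    have hsq : |u n| ^ 3 = u n ^ 2 * |u n| := by rw [← sq_abs]; ring
    calc _ = (N n * u n ^ 2) * Real.exp ((N n * u n ^ 2) * (K ^ 2 * D)) *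
        (|u n| * (K ^ 3 * D) + decouplingBound b K (u n) M r + u n ^ 2 * (K ^ 2 * D) ^ 2) := by
          rw [hsq, ← hD]; ring_nf
      _ ≤ _ := by
          have := hNu n
          gcongr
  have hlim : ∀ M r, Tendsto (fun n => T * Real.exp (T * (K ^ 2 * D)) *
      (|u n| * (K ^ 3 * D) + decouplingBound b K (u n) M r + u n ^ 2 * (K ^ 2 * D) ^ 2)) atTop
      (𝓝 (T * Real.exp (T * (K ^ 2 * D)) * decouplingBound b K 0 M r)) := by
    intro M r
    have hcont : Continuous fun x : ℝ => T * Real.exp (T * (K ^ 2 * D)) *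
      (|x| * (K ^ 3 * D) + decouplingBound b K x M r + x ^ 2 * (K ^ 2 * D) ^ 2) := by
      unfold decouplingBound
      fun_prop
    simpa [Function.comp_def] using (hcont.tendsto 0).comp hu
  have hev1 : ∀ᶠ n in atTop, |u n| * K ≤ 1 := by
    have : Tendsto (fun n => |u n| * K) atTop (𝓝 0) := by simpa using hu.abs.mul_const K
    exact (this.eventually (gt_mem_nhds one_pos)).mono fun n hn => hn.le
  have hev2 : ∀ᶠ n in atTop, u n ^ 2 * (K ^ 2 * D) ≤ 1 := by
    have : Tendsto (fun n => u n ^ 2 * (K ^ 2 * D)) atTop (𝓝 0) := by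
      simpa using (hu.pow 2).mul_const (K ^ 2 * D)
    exact (this.eventually (gt_mem_nhds one_pos)).mono fun n hn => hn.le
  rw [tendsto_iff_norm_sub_tendsto_zero]
  refine tendsto_order.2 ⟨fun a ha => .of_forall fun n => ha.trans_le (norm_nonneg _),
    fun ε hε => ?_⟩
  set A := T * Real.exp (T * (K ^ 2 * D)) with hA
  have hA0 : 0 ≤ A := by positivity
  -- `A + 1` rather than `A`, since `A = 0` when `T = 0`.
  obtain ⟨M, r, hMr⟩ := exists_decouplingBound_lt (K := K) hb (ε := ε / (A + 1)) (by positivity)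
  have hlt : A * decouplingBound b K 0 M r < ε := by
    rw [lt_div_iff₀ (by positivity)] at hMr
    have := h.decouplingBound_nonneg 0 M r
    linarith
  filter_upwards [hev1, hev2, (hlim M r).eventually (gt_mem_nhds hlt)] with n h1 h2 h3
  exact (hbound M r n h1 h2).trans_lt h3

end IsBoundedMixing

end CharFun

/-! ### Strong laws for functions of two coordinates, and averages over triangles. -/

section LawOfLargeNumbers

lemma sum_range_mul_eq_sum_sum (W : ℕ → ℝ) (d n : ℕ) :
    ∑ k ∈ Finset.range (d * n), W k
      = ∑ r ∈ Finset.range d, ∑ l ∈ Finset.range n, W (d * l + r) := by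
  rw [Finset.sum_comm]
  induction n with
  | zero => simp
  | succ n ih => rw [Nat.mul_succ, Finset.sum_range_add, ih, Finset.sum_range_succ]

/-- Averages of a bounded sequence converge if they do so along every residue class modulo `d`. -/
lemma tendsto_average_of_residues {W : ℕ → ℝ} {C m : ℝ} {d : ℕ} (hd : 0 < d)
    (hW : ∀ k, |W k| ≤ C)
    (hlim : ∀ r < d, Tendsto (fun n : ℕ => (∑ l ∈ Finset.range n, W (d * l + r)) / n) atTop (𝓝 m)) :
    Tendsto (fun n : ℕ => (∑ k ∈ Finset.range n, W k) / n) atTop (𝓝 m) := by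
  let V : ℕ → ℝ := fun k => W k - m
  have hsub : ∀ (W' : ℕ → ℝ) (n : ℕ), n ≠ 0 →
      (∑ l ∈ Finset.range n, (W' l - m)) / n = (∑ l ∈ Finset.range n, W' l) / n - m := by
    intro W' n hn
    have : (n : ℝ) ≠ 0 := Nat.cast_ne_zero.2 hn
    rw [Finset.sum_sub_distrib, Finset.sum_const, Finset.card_range, nsmul_eq_mul]
    field_simp
  have hV : ∀ k, |V k| ≤ C + |m| := fun k => (abs_sub _ _).trans (by gcongr; exact hW k)
  have hVlim : ∀ r < d,
      Tendsto (fun n : ℕ => (∑ l ∈ Finset.range n, V (d * l + r)) / n) atTop (𝓝 0) := by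
    intro r hr
    have := (hlim r hr).sub_const m
    rw [sub_self] at this
    refine this.congr' ?_
    filter_upwards [eventually_ne_atTop 0] with n hn
    exact (hsub (fun l => W (d * l + r)) n hn).symm
  have hblock : Tendsto (fun n : ℕ => (∑ k ∈ Finset.range (d * n), V k) / n) atTop (𝓝 0) := by
    simp_rw [sum_range_mul_eq_sum_sum, Finset.sum_div]
    rw [show (0 : ℝ) = ∑ r ∈ Finset.range d, (0 : ℝ) by simp]
    refine tendsto_finsetSum _ fun r hr => ?_
    simpa only [Finset.sum_div] using hVlim r (Finset.mem_range.1 hr)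
  have hdiv : Tendsto (fun n : ℕ => n / d) atTop atTop := Nat.tendsto_div_const_atTop hd.ne'
  have hzero : Tendsto (fun n : ℕ => (∑ k ∈ Finset.range n, V k) / n) atTop (𝓝 0) := by
    have hub : Tendsto (fun n : ℕ => |(∑ k ∈ Finset.range (d * (n / d)), V k) / ((n / d : ℕ) : ℝ)|
        + (d * (C + |m|)) / n) atTop (𝓝 0) := by
      simpa [Function.comp_def] using (hblock.comp hdiv).abs.add
        (tendsto_const_div_atTop_nhds_zero_nat (d * (C + |m|)))
    refine squeeze_zero_norm' ?_ hub
    filter_upwards [eventually_gt_atTop 0] with n hn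
    have hn' : (0 : ℝ) < n := by exact_mod_cast hn
    have hC : 0 ≤ C + |m| := (abs_nonneg _).trans (hV 0)
    have hsplit : ∑ k ∈ Finset.range n, V k = ∑ k ∈ Finset.range (d * (n / d)), V k
        + ∑ k ∈ Finset.range (n % d), V (d * (n / d) + k) := by
      rw [← Finset.sum_range_add, Nat.div_add_mod]
    rw [hsplit, add_div]
    refine (norm_add_le _ _).trans (add_le_add ?_ ?_)
    · rcases Nat.eq_zero_or_pos (n / d) with h0 | h0
      · simp [h0]
      · rw [norm_div, abs_div, Real.norm_eq_abs, Real.norm_eq_abs, Nat.abs_cast, Nat.abs_cast]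
        gcongr
        exact Nat.div_le_self n d
    · rw [norm_div, Real.norm_eq_abs (n : ℝ), Nat.abs_cast]
      gcongr
      refine (norm_sum_le_of_le _ fun k _ => hV _).trans ?_
      rw [Finset.sum_const, Finset.card_range, nsmul_eq_mul]
      gcongr
      exact (Nat.mod_lt n hd).le
  have := hzero.add_const m
  rw [zero_add] at this
  refine this.congr' ?_
  filter_upwards [eventually_ne_atTop 0] with n hn
  simp only [V]
  rw [hsub W n hn, sub_add_cancel]

variable {S : Type*} [MeasurableSpace S] (μ : Measure S) [IsProbabilityMeasure μ]

/-- Strong law of large numbers for a function of one coordinate. -/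
lemma ae_tendsto_average_eval {f : S → ℝ} (hf : Measurable f) (hfi : Integrable f μ) :
    ∀ᵐ s ∂(Measure.infinitePi fun _ : ℕ => μ),
      Tendsto (fun n : ℕ => (∑ j ∈ Finset.range n, f (s (j + 1))) / n) atTop (𝓝 (∫ y, f y ∂μ)) := by
  have hmap : ∀ j : ℕ, (Measure.infinitePi fun _ : ℕ => μ).map (fun s => s j) = μ := fun j =>
    Measure.infinitePi_map_eval (fun _ : ℕ => μ) j
  have hind : iIndepFun (fun (j : ℕ) (s : ℕ → S) => f (s j)) (Measure.infinitePi fun _ : ℕ => μ) :=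
    iIndepFun_infinitePi (X := fun _ => f) fun _ => hf
  have := strong_law_ae_real (μ := Measure.infinitePi fun _ : ℕ => μ) (fun j s => f (s (j + 1)))
    ?_ (fun i j hij => hind.indepFun (by omega)) ?_
  · convert this using 4
    rw [← integral_map (φ := fun s : ℕ → S => s (0 + 1)) (measurable_pi_apply _).aemeasurable
      hf.aestronglyMeasurable, hmap]
  · refine Integrable.comp_measurable (f := fun s : ℕ → S => s (0 + 1)) ?_ (by fun_prop)
    rwa [hmap]
  · intro j
    refine IdentDistrib.comp (f := fun s : ℕ → S => s (j + 1)) (g := fun s : ℕ → S => s (0 + 1))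
      ⟨(measurable_pi_apply _).aemeasurable, (measurable_pi_apply _).aemeasurable, ?_⟩ hf
    rw [hmap, hmap]

/-- Strong law of large numbers for a bounded function of two coordinates at a fixed distance. -/
lemma ae_tendsto_average_eval_prod {f : S × S → ℝ} (hf : Measurable f) {C : ℝ}
    (hC : ∀ z, |f z| ≤ C) (i : ℕ) :
    ∀ᵐ s ∂(Measure.infinitePi fun _ : ℕ => μ),
      Tendsto (fun n : ℕ => (∑ j ∈ Finset.range n, f (s (j + 1), s (j + 1 + (i + 1)))) / n) atTop
        (𝓝 (∫ z, f z ∂(μ.prod μ))) := by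
  have hmap : ∀ j : ℕ, (Measure.infinitePi fun _ : ℕ => μ).map
      (fun s => (s (j + 1), s (j + 1 + (i + 1)))) = μ.prod μ := fun j =>
    Measure.infinitePi_map_eval_prod (by omega)
  have hind : iIndepFun (fun (j : ℕ) (s : ℕ → S) => s j) (Measure.infinitePi fun _ : ℕ => μ) :=
    iIndepFun_infinitePi (X := fun _ x => x) fun _ => measurable_id
  -- Pairs at distance `i + 1` overlap in general, but starting points congruent modulo `i + 2` give
  -- disjoint, hence independent, pairs.
  have hres : ∀ r : ℕ, ∀ᵐ s ∂(Measure.infinitePi fun _ : ℕ => μ),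
      Tendsto (fun n : ℕ => (∑ l ∈ Finset.range n,
        f (s ((i + 2) * l + r + 1), s ((i + 2) * l + r + 1 + (i + 1)))) / n) atTop
        (𝓝 (∫ z, f z ∂(μ.prod μ))) := by
    intro r
    have := strong_law_ae_real (μ := Measure.infinitePi fun _ : ℕ => μ)
      (fun l s => f (s ((i + 2) * l + r + 1), s ((i + 2) * l + r + 1 + (i + 1)))) ?_ ?_ ?_
    · convert this using 4
      rw [← hmap ((i + 2) * 0 + r), integral_map (by fun_prop) hf.aestronglyMeasurable]
    · exact .of_bound (hf.comp (by fun_prop)).aestronglyMeasurable C (ae_of_all _ fun s => hC _)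
    · have hlt : ∀ l l', l < l' → (i + 2) * l + (i + 2) ≤ (i + 2) * l' := fun l l' h =>
        Nat.mul_le_mul_left (i + 2) h
      intro l l' hll
      have hcases : (i + 2) * l + (i + 2) ≤ (i + 2) * l' ∨ (i + 2) * l' + (i + 2) ≤ (i + 2) * l :=
        (lt_or_gt_of_ne hll).imp (hlt l l') (hlt l' l)
      refine (hind.indepFun_prodMk_prodMk (fun j => by fun_prop) ((i + 2) * l + r + 1)
        ((i + 2) * l + r + 1 + (i + 1)) ((i + 2) * l' + r + 1) ((i + 2) * l' + r + 1 + (i + 1))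
        ?_ ?_ ?_ ?_).comp hf hf <;> omega
    · intro l
      refine IdentDistrib.comp
        (f := fun s : ℕ → S => (s ((i + 2) * l + r + 1), s ((i + 2) * l + r + 1 + (i + 1))))
        (g := fun s : ℕ → S => (s ((i + 2) * 0 + r + 1), s ((i + 2) * 0 + r + 1 + (i + 1))))
        ⟨by fun_prop, by fun_prop, ?_⟩ hf
      rw [hmap, hmap]
  filter_upwards [ae_all_iff.2 hres] with s hs
  exact tendsto_average_of_residues (d := i + 2) (by omega) (fun k => hC _) fun r _ => hs r

/-- Summing by lag turns row sums into averages along each lag. The infinite sum, with empty inner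
sums from `i = n - 1` on, is in the form required by dominated convergence. -/
lemma sum_triangle_eq (f : ℕ → ℕ → ℝ) (n : ℕ) :
    ∑ k ∈ Finset.range n, ∑ j ∈ Finset.range k, f (k - 1 - j) j
      = ∑' i, ∑ j ∈ Finset.range (n - 1 - i), f i j := by
  have hsum : ∀ i ∉ Finset.range (n - 1), ∑ j ∈ Finset.range (n - 1 - i), f i j = 0 := by
    intro i hi
    rw [Finset.mem_range, not_lt] at hi
    simp [Nat.sub_eq_zero_of_le hi]
  rw [tsum_eq_sum hsum, ← Finset.sum_range_diag_flip]
  rcases n with _ | n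
  · simp
  rw [Finset.sum_range_succ', Finset.range_zero, Finset.sum_empty, add_zero]
  refine Finset.sum_congr rfl fun k _ => ?_
  rw [← Finset.sum_range_reflect]
  refine Finset.sum_congr rfl fun j hj => ?_
  have := Finset.mem_range.1 hj
  congr 1
  omega

/-- Averages of row sums of a triangular array with summable bounds. -/
lemma tendsto_average_triangle {f : ℕ → ℕ → ℝ} {B m : ℕ → ℝ} (hB : Summable B)
    (hf : ∀ i j, |f i j| ≤ B i)
    (hlim : ∀ i, Tendsto (fun n : ℕ => (∑ j ∈ Finset.range n, f i j) / n) atTop (𝓝 (m i))) :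
    Tendsto (fun n : ℕ => (∑ k ∈ Finset.range n, ∑ j ∈ Finset.range k, f (k - 1 - j) j) / n) atTop
      (𝓝 (∑' i, m i)) := by
  simp_rw [sum_triangle_eq, ← tsum_div_const]
  have hB0 : ∀ i, 0 ≤ B i := fun i => (abs_nonneg _).trans (hf i 0)
  refine tendsto_tsum_of_dominated_convergence hB (fun i => ?_) (.of_forall fun n i => ?_)
  · have hshift : Tendsto (fun n : ℕ => n - 1 - i) atTop atTop :=
      (tendsto_sub_atTop_nat i).comp (tendsto_sub_atTop_nat 1)
    have hratio : Tendsto (fun n : ℕ => ((n - 1 - i : ℕ) : ℝ) / n) atTop (𝓝 1) := by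
      have h1 : Tendsto (fun n : ℕ => 1 - ((1 + i : ℕ) : ℝ) / n) atTop (𝓝 (1 - 0)) :=
        tendsto_const_nhds.sub (tendsto_const_div_atTop_nhds_zero_nat _)
      rw [sub_zero] at h1
      refine h1.congr' ?_
      filter_upwards [eventually_ge_atTop (1 + i)] with n hn
      have : (n : ℝ) ≠ 0 := by
        have : n ≠ 0 := by omega
        exact_mod_cast this
      rw [Nat.sub_sub, Nat.cast_sub hn, sub_div, div_self this]
    have := ((hlim i).comp hshift).mul hratio
    rw [mul_one] at this
    refine this.congr fun n => ?_
    simp only [Function.comp_apply]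
    rcases Nat.eq_zero_or_pos (n - 1 - i) with h0 | h0
    · simp [h0]
    · have : ((n - 1 - i : ℕ) : ℝ) ≠ 0 := by exact_mod_cast h0.ne'
      field_simp
  · rw [norm_div, Real.norm_eq_abs, Real.norm_eq_abs, Nat.abs_cast]
    refine div_le_of_le_mul₀ (Nat.cast_nonneg n) (hB0 i) ?_
    refine (Finset.abs_sum_le_sum_abs _ _).trans ((Finset.sum_le_sum fun j _ => hf i j).trans ?_)
    rw [Finset.sum_const, Finset.card_range, nsmul_eq_mul, mul_comm]
    gcongr
    · exact hB0 i
    · omega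

end LawOfLargeNumbers

/-! ### Application to `g̃ (ξ k, s k)` for a typical environment `s`. -/

section Quenched

variable {Ω : Type*} [mΩ : MeasurableSpace Ω] {P : Measure Ω}
  {ν μ : Measure ℝ≥0} [IsProbabilityMeasure ν] [IsProbabilityMeasure μ] {ξ : ℕ → Ω → ℝ≥0}
  {g : ℝ≥0 × ℝ≥0 → ℝ} {C : ℝ}

lemma futureSigma_anti {Ω : Type*} (ξ : ℕ → Ω → ℝ≥0) : Antitone (futureSigma ξ) := fun _ _ h =>
  biSup_mono fun _ hi => le_trans h hi

lemma pastSigma_mono {Ω : Type*} (ξ : ℕ → Ω → ℝ≥0) : Monotone (pastSigma ξ) := fun _ _ h =>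
  biSup_mono fun _ hi => ⟨hi.1, hi.2.trans h⟩

lemma measurable_centered (hg : Measurable g) : Measurable (centered ν g) := by
  have h1 : StronglyMeasurable fun y : ℝ≥0 => ∫ v, g (v, y) ∂ν :=
    (hg.comp measurable_swap).stronglyMeasurable.integral_prod_right'
  exact hg.sub (h1.measurable.comp measurable_snd)

lemma abs_centered_le (hC : ∀ z, |g z| ≤ C) (z : ℝ≥0 × ℝ≥0) : |centered ν g z| ≤ 2 * C := by
  have h1 : |∫ v, g (v, z.2) ∂ν| ≤ C := by
    simpa using norm_integral_le_of_norm_le_const (μ := ν) (f := fun v => g (v, z.2))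
      (ae_of_all ν fun v => hC _)
  rw [centered, two_mul]
  exact (abs_sub _ _).trans (add_le_add (hC z) h1)

lemma integrable_centered_sq (hg : Measurable g) (hC : ∀ z, |g z| ≤ C) :
    Integrable (fun z => centered ν g z ^ 2) (ν.prod μ) := by
  refine .of_bound ((measurable_centered hg).pow_const 2).aestronglyMeasurable ((2 * C) ^ 2)
    (ae_of_all _ fun z => ?_)
  rw [norm_pow]
  exact pow_le_pow_left₀ (norm_nonneg _) (abs_centered_le hC z) 2

/-- The covariance of `g̃ (ξ 1, a)` and `g̃ (ξ (1 + i), b)`, as a function of `(a, b)`. -/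
noncomputable def lagCov (P : Measure Ω) (ν : Measure ℝ≥0) (ξ : ℕ → Ω → ℝ≥0)
    (g : ℝ≥0 × ℝ≥0 → ℝ) (i : ℕ) (z : ℝ≥0 × ℝ≥0) : ℝ :=
  ∫ ω, centered ν g (ξ 1 ω, z.1) * centered ν g (ξ (1 + i) ω, z.2) ∂P

lemma measurable_corrVar (hstat : IsPairStationary P ν ξ) (hg : Measurable g) (i : ℕ) :
    Measurable (corrVar ν ξ g i) := by
  have h1 := hstat.measurable 1 le_rfl
  have h2 := hstat.measurable (1 + i) (by omega)
  have h3 := measurable_centered (ν := ν) hg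
  exact (h3.comp (by fun_prop)).mul (h3.comp (by fun_prop))

lemma integral_mul_eq_lagCov (hstat : IsPairStationary P ν ξ) (hg : Measurable g)
    (s : ℕ → ℝ≥0) (j i : ℕ) :
    ∫ ω, centered ν g (ξ (j + i + 1) ω, s (j + i + 1)) * centered ν g (ξ (j + 1) ω, s (j + 1)) ∂P
      = lagCov P ν ξ g i (s (j + 1), s (j + i + 1)) := by
  have hm := fun l (hl : 1 ≤ l) => hstat.measurable l hl
  have hlaw : P.map (fun ω => (ξ (j + 1) ω, ξ (j + i + 1) ω))
      = P.map (fun ω => (ξ 1 ω, ξ (1 + i) ω)) := by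
    -- Pair stationarity is assumed only for shifts `τ ≥ 1`.
    rcases Nat.eq_zero_or_pos j with rfl | hj
    · simp [add_comm]
    · rw [hstat.pair_law_eq 1 (1 + i) j le_rfl (by omega) hj]
      simp only [show 1 + j = j + 1 by omega, show 1 + i + j = j + i + 1 by omega]
  let f : ℝ≥0 × ℝ≥0 → ℝ := fun x =>
    centered ν g (x.1, s (j + 1)) * centered ν g (x.2, s (j + i + 1))
  have hf : Measurable f := by
    have h3 := measurable_centered (ν := ν) hg
    exact (h3.comp (by fun_prop)).mul (h3.comp (by fun_prop))
  calc _ = ∫ ω, f (ξ (j + 1) ω, ξ (j + i + 1) ω) ∂P := by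
        congr 1 with ω
        exact mul_comm _ _
    _ = ∫ x, f x ∂P.map (fun ω => (ξ (j + 1) ω, ξ (j + i + 1) ω)) :=
        (integral_map ((hm _ (by omega)).prodMk (hm _ (by omega))).aemeasurable
          hf.aestronglyMeasurable).symm
    _ = ∫ ω, f (ξ 1 ω, ξ (1 + i) ω) ∂P := by
        rw [hlaw, integral_map ((hm _ le_rfl).prodMk (hm _ (by omega))).aemeasurable
          hf.aestronglyMeasurable]

lemma integral_centered_sq_eq (hstat : IsPairStationary P ν ξ) (hg : Measurable g)
    (hC : ∀ z, |g z| ≤ C) :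
    ∫ z, centered ν g z ^ 2 ∂(ν.prod μ) = ∫ y, lagCov P ν ξ g 0 (y, y) ∂μ := by
  rw [integral_prod_symm _ (integrable_centered_sq hg hC)]
  congr 1 with y
  have h1 : Measurable fun x => centered ν g (x, y) ^ 2 :=
    ((measurable_centered hg).comp (by fun_prop)).pow_const 2
  rw [lagCov, ← hstat.law_eq 1 le_rfl,
    integral_map (hstat.measurable 1 le_rfl).aemeasurable]
  · simp only [hstat.law_eq 1 le_rfl, sq, add_zero]
  · rw [hstat.law_eq 1 le_rfl]
    exact h1.aestronglyMeasurable

variable [IsProbabilityMeasure P]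

lemma abs_measureReal_inter_sub_mul_le_one (A B : Set Ω) :
    |P.real (A ∩ B) - P.real A * P.real B| ≤ 1 := by
  have h1 : P.real (A ∩ B) ≤ 1 := measureReal_le_one
  have h2 : P.real A * P.real B ≤ 1 :=
    mul_le_one₀ measureReal_le_one measureReal_nonneg measureReal_le_one
  have h3 : 0 ≤ P.real (A ∩ B) := measureReal_nonneg
  have h4 : 0 ≤ P.real A * P.real B := mul_nonneg measureReal_nonneg measureReal_nonneg
  rw [abs_le]
  constructor <;> linarith

lemma abs_sub_le_alpha {k l n : ℕ} (hkl : k + n ≤ l ∨ k = 0) {A B : Set Ω}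
    (hA : MeasurableSet[pastSigma ξ k] A) (hB : MeasurableSet[futureSigma ξ l] B) :
    |P.real (A ∩ B) - P.real A * P.real B| ≤ alpha P ξ n := by
  rcases Nat.eq_zero_or_pos k with rfl | hk
  · have hnonneg : 0 ≤ alpha P ξ n := by
      refine Real.sSup_nonneg ?_
      rintro _ ⟨_, _, _, _, _, _, rfl⟩
      exact abs_nonneg _
    have hbot : pastSigma ξ 0 = ⊥ := by simp [pastSigma]
    rw [hbot, MeasurableSpace.measurableSet_bot_iff] at hA
    rcases hA with rfl | rfl <;> simpa using hnonneg
  · refine le_csSup ⟨1, ?_⟩ ⟨k, hk, A, B, hA, futureSigma_anti ξ (by omega) _ hB, rfl⟩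
    rintro _ ⟨_, _, _, _, _, _, rfl⟩
    exact abs_measureReal_inter_sub_mul_le_one _ _

/-- Time `k` corresponds to `ξ (k + 1)`: a gap `n` between `F k` and `G (k + n)` is a gap `n + 1`
for `ξ`, which explains `alpha P ξ (n + 1)`. Centering holds for each fixed second argument,
whatever `s` is. -/
lemma isBoundedMixing_centered (hstat : IsPairStationary P ν ξ) (hg : Measurable g)
    (hC : ∀ z, |g z| ≤ C) (s : ℕ → ℝ≥0) :
    IsBoundedMixing P (fun k ω => centered ν g (ξ (k + 1) ω, s (k + 1))) (pastSigma ξ)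
      (fun k => futureSigma ξ (k + 1)) (fun n => alpha P ξ (n + 1)) (2 * C) where
  past_le k := iSup₂_le fun i hi => (hstat.measurable i hi.1).comap_le
  past_mono := pastSigma_mono ξ
  future_le k := iSup₂_le fun i hi =>
    (hstat.measurable i (le_trans (Nat.le_add_left 1 k) hi)).comap_le
  future_anti _ _ h := futureSigma_anti ξ (by omega)
  mixing k l n hkl A B hA hB := abs_sub_le_alpha (by omega) hA hB
  measurable_past k := by
    have h1 : Measurable[pastSigma ξ (k + 1)] (ξ (k + 1)) :=
      (comap_measurable _).mono
        (le_iSup₂ (f := fun i (_ : i ∈ Set.Icc 1 (k + 1)) => MeasurableSpace.comap (ξ i) _)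
          (k + 1) ⟨by omega, le_rfl⟩) le_rfl
    exact (measurable_centered hg).comp (h1.prodMk measurable_const)
  measurable_future k := by
    have h1 : Measurable[futureSigma ξ (k + 1)] (ξ (k + 1)) :=
      (comap_measurable _).mono
        (le_iSup₂ (f := fun i (_ : i ∈ Set.Ici (k + 1)) => MeasurableSpace.comap (ξ i) _)
          (k + 1) (Set.mem_Ici.2 le_rfl)) le_rfl
    exact (measurable_centered hg).comp (h1.prodMk measurable_const)
  abs_le k ω := abs_centered_le hC _
  integral_eq_zero k := by
    have hm := hstat.measurable (k + 1) (by omega)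
    have hgs : Measurable fun v => g (v, s (k + 1)) := hg.comp (by fun_prop)
    have hi : Integrable (fun ω => g (ξ (k + 1) ω, s (k + 1))) P :=
      .of_bound (hgs.comp hm).aestronglyMeasurable C (ae_of_all _ fun ω => hC _)
    simp only [centered]
    rw [integral_sub hi (integrable_const _), integral_const, probReal_univ, one_smul,
      ← hstat.law_eq (k + 1) (by omega), integral_map hm.aemeasurable hgs.aestronglyMeasurable,
      sub_self]

lemma measurable_lagCov (hstat : IsPairStationary P ν ξ) (hg : Measurable g) (i : ℕ) :
    Measurable (lagCov P ν ξ g i) :=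
  (StronglyMeasurable.integral_prod_left' (μ := P)
    (measurable_corrVar hstat hg i).stronglyMeasurable).measurable

lemma integrable_corrVar (hstat : IsPairStationary P ν ξ) (hg : Measurable g)
    (hC : ∀ z, |g z| ≤ C) (i : ℕ) : Integrable (corrVar ν ξ g i) (P.prod (μ.prod μ)) := by
  refine .of_bound (measurable_corrVar hstat hg i).aestronglyMeasurable (2 * C * (2 * C))
    (ae_of_all _ fun w => ?_)
  rw [corrVar, norm_mul]
  exact mul_le_mul (abs_centered_le hC _) (abs_centered_le hC _) (norm_nonneg _)
    ((abs_nonneg _).trans (abs_centered_le (ν := ν) hC (0, 0)))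

lemma corr_eq_integral_lagCov (hstat : IsPairStationary P ν ξ) (hg : Measurable g)
    (hC : ∀ z, |g z| ≤ C) (i : ℕ) : corr P ν μ ξ g i = ∫ z, lagCov P ν ξ g i z ∂(μ.prod μ) := by
  rw [corr, integral_prod_symm _ (integrable_corrVar hstat hg hC i)]
  rfl

lemma abs_lagCov_succ_le (hstat : IsPairStationary P ν ξ) (hg : Measurable g)
    (hC : ∀ z, |g z| ≤ C) (i : ℕ) (z : ℝ≥0 × ℝ≥0) :
    |lagCov P ν ξ g (i + 1) z| ≤ 4 * (2 * C) ^ 2 * alpha P ξ (i + 1) := by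
  -- An environment taking the prescribed values at times `1` and `i + 2`.
  let s : ℕ → ℝ≥0 := fun n => if n = 1 then z.1 else z.2
  have h1 := (isBoundedMixing_centered hstat hg hC s).abs_integral_mul_le
    (j := 0) (k := 0 + (i + 1)) (by omega)
  rw [integral_mul_eq_lagCov hstat hg s 0 (i + 1)] at h1
  simpa [s] using h1

lemma abs_lagCov_le (hC : ∀ z, |g z| ≤ C) (i : ℕ) (z : ℝ≥0 × ℝ≥0) :
    |lagCov P ν ξ g i z| ≤ 2 * C * (2 * C) := by
  simpa [lagCov] using norm_integral_le_of_norm_le_const (μ := P)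
    (f := fun ω => centered ν g (ξ 1 ω, z.1) * centered ν g (ξ (1 + i) ω, z.2))
    (ae_of_all P fun ω => by
      rw [norm_mul]
      exact mul_le_mul (abs_centered_le hC _) (abs_centered_le hC _) (norm_nonneg _)
        ((abs_nonneg _).trans (abs_centered_le (ν := ν) hC (0, 0))))

lemma summable_corr (hstat : IsPairStationary P ν ξ)
    (hmix : Summable fun n : ℕ => alpha P ξ (n + 1)) (hg : Measurable g) (hC : ∀ z, |g z| ≤ C) :
    Summable fun k : ℕ => corr P ν μ ξ g (k + 1) := by
  refine .of_norm_bounded (hmix.mul_left (4 * (2 * C) ^ 2)) fun k => ?_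
  rw [corr_eq_integral_lagCov hstat hg hC]
  simpa using norm_integral_le_of_norm_le_const (μ := μ.prod μ)
    (f := lagCov P ν ξ g (k + 1)) (ae_of_all _ fun z => abs_lagCov_succ_le hstat hg hC k z)

/-- Quenched convergence of the averaged variance. -/
lemma ae_tendsto_average_halfVarIncr (hstat : IsPairStationary P ν ξ)
    (hmix : Summable fun n : ℕ => alpha P ξ (n + 1)) (hg : Measurable g) (hC : ∀ z, |g z| ≤ C) :
    ∀ᵐ s ∂(Measure.infinitePi fun _ : ℕ => μ),
      Tendsto (fun n : ℕ => (∑ k ∈ Finset.range n,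
        halfVarIncr P (fun k ω => centered ν g (ξ (k + 1) ω, s (k + 1))) k) / n) atTop
        (𝓝 (rhoSq P ν μ ξ g / 2)) := by
  have hdiagm : Measurable fun y => lagCov P ν ξ g 0 (y, y) :=
    (measurable_lagCov hstat hg 0).comp (by fun_prop)
  have hdiag := ae_tendsto_average_eval μ hdiagm
    (.of_bound hdiagm.aestronglyMeasurable _ (ae_of_all _ fun y => abs_lagCov_le hC 0 (y, y)))
  have hoff : ∀ i : ℕ, _ := fun i =>
    ae_tendsto_average_eval_prod μ (measurable_lagCov hstat hg (i + 1))
      (abs_lagCov_le hC (i + 1)) i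
  filter_upwards [hdiag, ae_all_iff.2 hoff] with s hs1 hs2
  have htri := tendsto_average_triangle (hmix.mul_left (4 * (2 * C) ^ 2))
    (fun i j => abs_lagCov_succ_le hstat hg hC i _) hs2
  have hlim := (hs1.div_const 2).add htri
  have hrho : rhoSq P ν μ ξ g / 2 = (∫ y, lagCov P ν ξ g 0 (y, y) ∂μ) / 2
      + ∑' i, ∫ z, lagCov P ν ξ g (i + 1) z ∂(μ.prod μ) := by
    simp_rw [rhoSq, integral_centered_sq_eq hstat hg hC, corr_eq_integral_lagCov hstat hg hC]
    ring
  rw [hrho]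
  refine hlim.congr fun n => ?_
  rw [div_right_comm, ← add_div, Finset.sum_div, ← Finset.sum_add_distrib]
  congr 1
  refine Finset.sum_congr rfl fun k _ => ?_
  rw [halfVarIncr]
  congr 1
  · have := integral_mul_eq_lagCov hstat hg s k 0
    simp only [add_zero] at this
    rw [this]
  · refine Finset.sum_congr rfl fun j hj => ?_
    have hj := Finset.mem_range.1 hj
    have := integral_mul_eq_lagCov hstat hg s j (k - 1 - j + 1)
    rw [show j + (k - 1 - j + 1) + 1 = k + 1 by omega] at this
    rw [this, show j + 1 + (k - 1 - j + 1) = k + 1 by omega]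

lemma tendsto_integral_expSum {μ : Measure ℝ≥0} (hstat : IsPairStationary P ν ξ)
    (hmix : Summable fun n : ℕ => alpha P ξ (n + 1)) (hg : Measurable g) (hC : ∀ z, |g z| ≤ C)
    {s : ℕ → ℝ≥0} (hs : Tendsto (fun n : ℕ => (∑ k ∈ Finset.range n,
        halfVarIncr P (fun k ω => centered ν g (ξ (k + 1) ω, s (k + 1))) k) / n) atTop
        (𝓝 (rhoSq P ν μ ξ g / 2))) (t : ℝ) :
    Tendsto (fun n : ℕ => ∫ ω, expSum (fun k ω => centered ν g (ξ (k + 1) ω, s (k + 1)))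
      (t / √(2 * n)) (2 * n - 1) ω ∂P) atTop (𝓝 (Real.exp (-(t ^ 2 * rhoSq P ν μ ξ g / 2)) : ℝ)) := by
  set X : ℕ → Ω → ℝ := fun k ω => centered ν g (ξ (k + 1) ω, s (k + 1)) with hX
  have hsq : ∀ n : ℕ, (t / √(2 * n)) ^ 2 = t ^ 2 / (2 * n) := fun n => by
    rw [div_pow, Real.sq_sqrt (by positivity)]
  have hu : Tendsto (fun n : ℕ => t / √(2 * (n : ℝ))) atTop (𝓝 0) :=
    tendsto_const_nhds.div_atTop (Real.tendsto_sqrt_atTop.comp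
      (tendsto_natCast_atTop_atTop.const_mul_atTop two_pos))
  have hle : ∀ n : ℕ, ((2 * n - 1 : ℕ) : ℝ) ≤ 2 * n := fun n => by
    exact_mod_cast Nat.sub_le (2 * n) 1
  have hNu : ∀ n : ℕ, ((2 * n - 1 : ℕ) : ℝ) * (t / √(2 * (n : ℝ))) ^ 2 ≤ t ^ 2 := fun n => by
    rw [hsq, mul_div_assoc', mul_comm]
    -- This form also covers `n = 0`, where division by zero gives zero.
    exact div_le_of_le_mul₀ (by positivity) (sq_nonneg t)
      (mul_le_mul_of_nonneg_left (hle n) (sq_nonneg t))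
  have h1 := (isBoundedMixing_centered hstat hg hC s).tendsto_integral_expSum_mul_exp hmix hu hNu
  have hN : Tendsto (fun n : ℕ => 2 * n - 1) atTop atTop :=
    (tendsto_sub_atTop_nat 1).comp (tendsto_id.const_mul_atTop' two_pos)
  have hratio : Tendsto (fun n : ℕ => ((2 * n - 1 : ℕ) : ℝ) / (2 * n)) atTop (𝓝 1) := by
    have h2 : Tendsto (fun n : ℕ => 1 - (1 / 2 : ℝ) / n) atTop (𝓝 (1 - 0)) :=
      tendsto_const_nhds.sub (tendsto_const_div_atTop_nhds_zero_nat _)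
    rw [sub_zero] at h2
    refine h2.congr' ?_
    filter_upwards [eventually_ge_atTop 1] with n hn
    have : (n : ℝ) ≠ 0 := by
      have : n ≠ 0 := by omega
      exact_mod_cast this
    rw [Nat.cast_sub (by omega)]
    push_cast
    field_simp
  have h3 : Tendsto (fun n : ℕ => ∑ k ∈ Finset.range (2 * n - 1),
      (t / √(2 * (n : ℝ))) ^ 2 * halfVarIncr P X k) atTop (𝓝 (t ^ 2 * rhoSq P ν μ ξ g / 2)) := by
    have h4 := ((hs.comp hN).mul hratio).const_mul (t ^ 2)
    rw [mul_one, mul_div_assoc'] at h4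
    refine h4.congr fun n => ?_
    rw [← Finset.mul_sum, hsq]
    simp only [Function.comp_apply]
    rcases Nat.eq_zero_or_pos (2 * n - 1) with h0 | h0
    · simp [h0]
    · have hn : (n : ℝ) ≠ 0 := by
        have : n ≠ 0 := by omega
        exact_mod_cast this
      have : ((2 * n - 1 : ℕ) : ℝ) ≠ 0 := by exact_mod_cast h0.ne'
      field_simp
  have h5 : Tendsto (fun n : ℕ => ((Real.exp (-∑ k ∈ Finset.range (2 * n - 1),
      (t / √(2 * (n : ℝ))) ^ 2 * halfVarIncr P X k) : ℝ) : ℂ)) atTop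
      (𝓝 (Real.exp (-(t ^ 2 * rhoSq P ν μ ξ g / 2)) : ℝ)) :=
    (Complex.continuous_ofReal.tendsto _).comp ((Real.continuous_exp.tendsto _).comp h3.neg)
  have h6 := h1.mul h5
  rw [one_mul] at h6
  refine h6.congr fun n => ?_
  rw [mul_assoc, ← Complex.ofReal_mul, ← Real.exp_add, add_neg_cancel, Real.exp_zero,
    Complex.ofReal_one, mul_one]

/-- For one good `s`, `exp (-ρ²/2)` is a limit of characteristic function values at `t = 1`, all of
modulus at most 1. -/
lemma rhoSq_nonneg (hstat : IsPairStationary P ν ξ)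
    (hmix : Summable fun n : ℕ => alpha P ξ (n + 1)) (hg : Measurable g) (hC : ∀ z, |g z| ≤ C) :
    0 ≤ rhoSq P ν μ ξ g := by
  obtain ⟨s, hs⟩ := (ae_tendsto_average_halfVarIncr (μ := μ) hstat hmix hg hC).exists
  have h1 := (tendsto_integral_expSum hstat hmix hg hC hs 1).norm
  have h2 := le_of_tendsto' h1 fun n => IsBoundedMixing.norm_integral_expSum_le _ _
  rw [Complex.norm_real, Real.norm_of_nonneg (Real.exp_pos _).le, Real.exp_le_one_iff] at h2
  linarith

end Quenched

end QuenchedCLT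

/-! ### Conclusion by Lévy's continuity theorem. -/

theorem theorem3 {Ω : Type*} [MeasurableSpace Ω] (P : Measure Ω) [IsProbabilityMeasure P]
    (ν μ : Measure ℝ≥0) [IsProbabilityMeasure ν] [IsProbabilityMeasure μ]
    (ξ : ℕ → Ω → ℝ≥0)
    (hstat : QuenchedCLT.IsPairStationary P ν ξ)
    (hmix : Summable (fun n : ℕ => QuenchedCLT.alpha P ξ (n + 1)))
    (hblocks : ∃ p q : ℕ → ℕ, QuenchedCLT.IsBlockPair (QuenchedCLT.alpha P ξ) p q)
    (g : ℝ≥0 × ℝ≥0 → ℝ) (hg : Measurable g) (hbdd : ∃ C : ℝ, ∀ z, |g z| ≤ C) :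
    -- the limiting variance is well defined and finite (and nonnegative)
    Integrable (fun z => QuenchedCLT.centered ν g z ^ 2) (ν.prod μ) ∧
    (∀ k : ℕ, 1 ≤ k → Integrable (QuenchedCLT.corrVar ν ξ g k) (P.prod (μ.prod μ))) ∧
    Summable (fun k : ℕ => QuenchedCLT.corr P ν μ ξ g (k + 1)) ∧
    0 ≤ QuenchedCLT.rhoSq P ν μ ξ g ∧
    -- the quenched central limit theorem
    ∀ᵐ s ∂(Measure.infinitePi (fun _ : ℕ => μ)),
      TendstoInDistribution
        (fun (n : ℕ) (ω : Ω) =>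
          (∑ j ∈ Finset.Icc 1 (2 * n - 1), QuenchedCLT.centered ν g (ξ j ω, s j)) /
            √(2 * (n : ℝ)))
        atTop (id : ℝ → ℝ) (fun _ => P)
        (gaussianReal 0 (QuenchedCLT.rhoSq P ν μ ξ g).toNNReal) := by
  obtain ⟨C, hC⟩ := hbdd
  have hrho := QuenchedCLT.rhoSq_nonneg (μ := μ) hstat hmix hg hC
  refine ⟨QuenchedCLT.integrable_centered_sq hg hC,
    fun k _ => QuenchedCLT.integrable_corrVar hstat hg hC k,
    QuenchedCLT.summable_corr hstat hmix hg hC, hrho, ?_⟩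
  filter_upwards [QuenchedCLT.ae_tendsto_average_halfVarIncr (μ := μ) hstat hmix hg hC] with s hs
  have hmeas : ∀ n : ℕ, Measurable fun ω =>
      (∑ j ∈ Finset.Icc 1 (2 * n - 1), QuenchedCLT.centered ν g (ξ j ω, s j)) / √(2 * (n : ℝ)) :=
    fun n => (Finset.measurable_fun_sum _ fun j hj => (QuenchedCLT.measurable_centered hg).comp
      ((hstat.measurable j (Finset.mem_Icc.1 hj).1).prodMk measurable_const)).div_const _
  refine ⟨fun n => (hmeas n).aemeasurable, aemeasurable_id, ?_⟩
  refine ProbabilityMeasure.tendsto_iff_tendsto_charFun.2 fun t => ?_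
  have hlim := QuenchedCLT.tendsto_integral_expSum hstat hmix hg hC hs t
  have hgauss : charFun ((gaussianReal 0 (QuenchedCLT.rhoSq P ν μ ξ g).toNNReal).map id) t
      = (Real.exp (-(t ^ 2 * QuenchedCLT.rhoSq P ν μ ξ g / 2)) : ℝ) := by
    -- Nonnegativity of `ρ²` ensures that `toNNReal` does not truncate the variance.
    rw [Measure.map_id, charFun_gaussianReal, Real.coe_toNNReal _ hrho]
    push_cast
    ring_nf
  change Tendsto _ _ (𝓝 (charFun ((gaussianReal 0 _).map id) t))
  rw [hgauss]
  refine hlim.congr fun n => ?_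
  change _ = charFun (P.map _) t
  rw [charFun_apply_real, integral_map (hmeas n).aemeasurable (by fun_prop)]
  congr 1 with ω
  rw [QuenchedCLT.expSum, Finset.range_eq_Ico,
    Finset.sum_Ico_add' (fun j => QuenchedCLT.centered ν g (ξ j ω, s j)) 0 (2 * n - 1) 1, zero_add,
    ← Finset.Ico_add_one_right_eq_Icc]
  congr 1
  push_cast
  ring
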